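/- **Setting.** Let $N,s\in\mathbb N_0$, let $V_I:\mathbb R^{sN}\to\mathbb R$ be continuous and bounded, and consider the Lagrangean $L(x(t))=\tfrac12\dot x(t)^2-V_I(x(t))$. Let $\mathcal C$ be the space of smooth orbits $x:\mathbb R\to\mathbb R^{sN}$ and $\mathcal C_0\subset\mathcal C$ the subspace of loops, i.e. orbits with compact support in time. For $F:\mathcal C\to\mathbb R$ and $x_0\in\mathcal C_0$ put $F^{x_0}[x]=F[x+x_0]$. Let $\mathcal F$ be the smallest real linear space of functionals $F:\mathcal C\to\mathbb R$ that is stable under all shifts $F\mapsto F^{x_0}$, $x_0\in\mathcal C_0$, and contains the functionals $$x\mapsto\int dt\,\Big(f_0(t)\cdot x(t)+\sum_{k=1}^n g_k(t)V_k(x(t))\Big),$$ with $f_0\in\mathcal C_0$, $g_k\in\mathcal D(\mathbb R)$ and $V_k:\mathbb R^{sN}\to\mathbb R$ continuous and bounded. The support of $F$ is the set of times $t$ such that every neighbourhood of $t$ contains the support of some loop $x_0$ with $F^{x_0}\ne F$; $F_1$ lies in the future of $F_2$ if every point of the support of $F_1$ is later than every point of the support of $F_2$. Put $\delta L(x_0)[x]=\int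 dt\,\big(L(x(t)+x_0(t))-L(x(t))\big)$, which belongs to $\mathcal F$, and let $F_h$ be the constant functional with value $h\in\mathbb R$. The dynamical group $\mathcal G_L$ is the group generated by symbols $S(F)$, $F\in\mathcal F$, with the relations $S(0)=1$, $S(F)=S(F^{x_0}+\delta L(x_0))$ for $F\in\mathcal F$, $x_0\in\mathcal C_0$, and $S(F_1+F_2+F_3)=S(F_1+F_3)S(F_3)^{-1}S(F_2+F_3)$ whenever $F_1$ lies in the future of $F_2$. The dynamical algebra $\mathcal A_L$ is the C*-algebra obtained from the complex group algebra of $\mathcal G_L$ (with $(\sum c\,S)^*=\sum\overline c\,S^{-1}$), in which one sets $S(F_h)=e^{ih}1$ for all $h\in\mathbb R$, by completion in the norm $\|A\|^2=\sup_{\omega'}\omega'(A^*A)$, where the supremum extends over all states $\omega'$. Let $(\pi,\mathcal H)$ be an irreducible representation of $\mathcal A_L$ on a Hilbert space, i.e. $\pi(\mathcal A_L)''=\mathcal B(\mathcal H)$, and let $\mathcal A_L^-$ be the closure of $\pi(\mathcal A_L)$ in the weak operator topology. For a normalized vector $\Omega\in\mathcal H$ let $\omega(A)=\langle\Omega,\pi(A)\Omega\rangle$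 be its vector state, and for a unitary $S\in\mathcal A_L$ let $\omega_S=\omega\circ\mathrm{Ad}\,S^{-1}$, i.e. $\omega_S(A)=\omega(S^{-1}AS)$; these states are extended to $\mathcal A_L^-$ by $\omega(X)=\langle\Omega,X\Omega\rangle$ and $\omega_S(X)=\langle\pi(S)\Omega,X\pi(S)\Omega\rangle$. The transition probability is $\omega\cdot\omega_S=|\omega(S)|^2$. **Theorem.** Let $\mathcal H_N\subset\mathcal H$ be any finite dimensional subspace, let $E\in\mathcal A_L^-$ be any infinite dimensional (orthogonal) projection, and let $\varepsilon>0$. There exists a unitary $S_\varepsilon\in\mathcal A_L$ such that for every vector state $\omega$ given by a normalized vector $\Omega\in\mathcal H_N$ $$\omega_{S_\varepsilon}(1-E)<\varepsilon\quad\text{and}\quad|\omega\cdot\omega_{S_\varepsilon}-\omega(E)^2|<\varepsilon .$$ -/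

import Mathlib

open scoped ContDiff ComplexOrder InnerProductSpace Topology BoundedContinuousFunction
open MeasureTheory

noncomputable section

namespace DynAlg

/-! ### Classical mechanics: orbits, loops, functionals, Lagrangeans -/

/-- The configuration space `ℝ^(sN)` of `N` particles in `ℝ^s`, with its Euclidean structure. -/
abbrev Config (N s : ℕ) : Type := EuclideanSpace ℝ (Fin N × Fin s)

/-- The space `𝒞` of orbits: smooth functions from time to configuration space. -/
def Orbit (N s : ℕ) : Submodule ℝ (ℝ → Config N s) where
  carrier := {x | ContDiff ℝ ∞ x}
  add_mem' {x y} (hx : ContDiff ℝ ∞ x) (hy : ContDiff ℝ ∞ y) :=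
    show ContDiff ℝ ∞ (x + y) from hx.add hy
  zero_mem' := show ContDiff ℝ ∞ (fun _ : ℝ => (0 : Config N s)) from contDiff_const
  smul_mem' c x (hx : ContDiff ℝ ∞ x) := show ContDiff ℝ ∞ (c • x) from contDiff_const.smul hx

/-- The space `𝒞₀ ⊆ 𝒞` of loops: orbits with compact support in time. -/
def Loop (N s : ℕ) : Submodule ℝ (Orbit N s) where
  carrier := {x | HasCompactSupport (x : ℝ → Config N s)}
  add_mem' := fun hx hy => HasCompactSupport.add hx hy
  zero_mem' := HasCompactSupport.zero
  smul_mem' := fun c _ hx => HasCompactSupport.smul_left (f := fun _ : ℝ => c) hx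

variable {N s : ℕ}

instance : CoeFun (Orbit N s) (fun _ => ℝ → Config N s) := ⟨fun x => x.1⟩

instance : CoeFun (Loop N s) (fun _ => ℝ → Config N s) := ⟨fun x => x.1.1⟩

/-- The functional `x ↦ ∫ (f₀(t) · x(t) + ∑ₖ gₖ(t) Vₖ(x(t))) dt`. -/
def basicFunctional (f₀ : Loop N s) {n : ℕ} (g : Fin n → ℝ → ℝ) (V : Fin n → (Config N s →ᵇ ℝ)) :
    Orbit N s → ℝ := fun x =>
  ∫ t, (inner ℝ (f₀ t) (x t) +
    ∑ k, g k t * V k (x t))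

/-- The functionals of the above form, with `f₀` a loop, `gₖ` test functions, and `Vₖ` bounded
continuous functions. -/
def basicFunctionals (N s : ℕ) : Set (Orbit N s → ℝ) :=
  {F | ∃ (f₀ : Loop N s) (n : ℕ) (g : Fin n → ℝ → ℝ) (V : Fin n → (Config N s →ᵇ ℝ)),
    (∀ k, ContDiff ℝ ∞ (g k) ∧ HasCompactSupport (g k)) ∧ F = basicFunctional f₀ g V}

/-- The shifted functional `F^{x₀}[x] = F[x + x₀]`, as a linear operation on functionals. -/
def shift (x₀ : Loop N s) : (Orbit N s → ℝ) →ₗ[ℝ] (Orbit N s → ℝ) where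
  toFun F := fun x => F (x + (x₀ : Orbit N s))
  map_add' _ _ := rfl
  map_smul' _ _ := rfl

/-- The space `𝓕` of functionals: the smallest linear space of functionals which contains the basic
functionals and is stable under shifts by loops.  (The stability is needed for the dynamical
relations; the shifted interaction `V(x(t) + x₀(t))` is in general not a finite sum of terms
`gₖ(t) Vₖ(x(t))`.) -/
def Functionals (N s : ℕ) : Submodule ℝ (Orbit N s → ℝ) :=
  Submodule.span ℝ {F | ∃ (x₀ : Loop N s), ∃ F₀ ∈ basicFunctionals N s, F = shift x₀ F₀}

/-- The support of a functional: the times `t` such that in each neighbourhood of `t` there is the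
support of some loop `x₀` with `F^{x₀} ≠ F`. -/
def timeSupport (F : Orbit N s → ℝ) : Set ℝ :=
  {t | ∀ U ∈ 𝓝 t, ∃ x₀ : Loop N s, tsupport ⇑x₀ ⊆ U ∧ shift x₀ F ≠ F}

/-- `F₁` lies in the future of `F₂`: the support of `F₁` is later than that of `F₂`. -/
def InFuture (F₁ F₂ : Orbit N s → ℝ) : Prop :=
  ∀ t₁ ∈ timeSupport F₁, ∀ t₂ ∈ timeSupport F₂, t₂ < t₁

/-- The Lagrangean `L(x(t)) = ẋ(t)²/2 - V(x(t))` with bounded continuous interaction potential. -/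
def lagrangean (V : Config N s →ᵇ ℝ) (x : Orbit N s) (t : ℝ) : ℝ :=
  (1 / 2) * ‖deriv x t‖ ^ 2 - V (x t)

/-- The variation `δL(x₀)` of the action. The integrand vanishes off the support of `x₀`, so that no
cutoff is needed; see `actionVariation_eq_cutoff`. -/
def actionVariation (V : Config N s →ᵇ ℝ) (x₀ : Loop N s) : Orbit N s → ℝ := fun x =>
  ∫ t, (lagrangean V (x + (x₀ : Orbit N s)) t - lagrangean V x t)

/-- The constant functionals. -/
def constFunctional (N s : ℕ) (h : ℝ) : Orbit N s → ℝ := fun _ => h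

/-! Membership of these functionals in `𝓕`. -/

theorem orbit_contDiff (x : Orbit N s) : ContDiff ℝ ∞ ⇑x := x.2

theorem loop_contDiff (x₀ : Loop N s) : ContDiff ℝ ∞ ⇑x₀ := x₀.1.2

theorem loop_compact (x₀ : Loop N s) : HasCompactSupport ⇑x₀ := x₀.2

theorem orbit_hasDerivAt (x : Orbit N s) (t : ℝ) :
    HasDerivAt ⇑x (deriv x t) t :=
  (((orbit_contDiff x).differentiable (by simp)) t).hasDerivAt

theorem orbit_deriv_add (x : Orbit N s) (x₀ : Loop N s) (t : ℝ) :
    deriv (x + (x₀ : Orbit N s)) t =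
      deriv x t + deriv ⇑x₀ t :=
  ((orbit_hasDerivAt x t).add (orbit_hasDerivAt (x₀ : Orbit N s) t)).deriv

theorem lagrangean_add_sub_eq_zero (V : Config N s →ᵇ ℝ) (x₀ : Loop N s) (x : Orbit N s) {t : ℝ}
    (ht : t ∉ tsupport ⇑x₀) :
    lagrangean V (x + (x₀ : Orbit N s)) t - lagrangean V x t = 0 := by
  have h1 : deriv ⇑x₀ t = 0 := by
    by_contra h
    exact ht (support_deriv_subset h)
  have h2 : x₀ t = 0 := image_eq_zero_of_notMem_tsupport ht
  have h3 : (x + (x₀ : Orbit N s)) t =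
      x t + x₀ t := rfl
  rw [lagrangean, lagrangean, orbit_deriv_add, h1, h3, h2]
  simp

theorem actionVariation_eq_cutoff (V : Config N s →ᵇ ℝ) (x₀ : Loop N s) (x : Orbit N s)
    (χ : ℝ → ℝ) (hχ : ∀ t ∈ tsupport ⇑x₀, χ t = 1) :
    actionVariation V x₀ x =
      ∫ t, χ t * (lagrangean V (x + (x₀ : Orbit N s)) t - lagrangean V x t) := by
  refine integral_congr_ae (Filter.Eventually.of_forall fun t => ?_)
  by_cases ht : t ∈ tsupport ⇑x₀
  · simp [hχ t ht]
  · simp [lagrangean_add_sub_eq_zero V x₀ x ht]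

theorem basic_mem {F : Orbit N s → ℝ} (hF : F ∈ basicFunctionals N s) : F ∈ Functionals N s := by
  refine Submodule.subset_span ⟨0, F, hF, ?_⟩
  funext x
  simp [shift]

theorem shift_mem (x₀ : Loop N s) {F : Orbit N s → ℝ} (hF : F ∈ Functionals N s) :
    shift x₀ F ∈ Functionals N s := by
  have : Functionals N s ≤ (Functionals N s).comap (shift x₀) := by
    refine Submodule.span_le.2 ?_
    rintro _ ⟨y, F₀, h₀, rfl⟩
    refine Submodule.subset_span ⟨x₀ + y, F₀, h₀, ?_⟩
    funext x
    simp [shift, add_assoc]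
  exact this hF

theorem const_mem (h : ℝ) : constFunctional N s h ∈ Functionals N s := by
  let f : ContDiffBump (0 : ℝ) := ⟨1, 2, one_pos, one_lt_two⟩
  refine basic_mem ⟨0, 1, fun _ t => h * f.normed volume t,
    fun _ => BoundedContinuousFunction.const _ 1, fun _ => ⟨?_, ?_⟩, ?_⟩
  · exact contDiff_const.mul f.contDiff_normed
  · exact f.hasCompactSupport_normed.mul_left
  · funext x
    simp [constFunctional, basicFunctional, integral_const_mul, f.integral_normed]

theorem actionVariation_mem (V : Config N s →ᵇ ℝ) (x₀ : Loop N s) :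
    actionVariation V x₀ ∈ Functionals N s := by
  have hd1 : ContDiff ℝ ∞ (deriv ⇑x₀) := (loop_contDiff x₀).deriv'
  have hd2 : ContDiff ℝ ∞ (deriv (deriv ⇑x₀)) := hd1.deriv'
  have hc1 : HasCompactSupport (deriv ⇑x₀) := (loop_compact x₀).deriv
  have hc2 : HasCompactSupport (deriv (deriv ⇑x₀)) := hc1.deriv
  let f : Loop N s := ⟨⟨fun t => - deriv (deriv ⇑x₀) t, hd2.neg⟩, hc2.neg⟩
  obtain ⟨R, hR⟩ := (loop_compact x₀).isBounded.subset_closedBall (0 : ℝ)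
  let χ : ContDiffBump (0 : ℝ) := ⟨max R 1, max R 1 + 1, by positivity, by simp⟩
  have hχ : ∀ t ∈ tsupport ⇑x₀, χ t = 1 := fun t ht =>
    χ.one_of_mem_closedBall (Metric.closedBall_subset_closedBall (le_max_left _ _) (hR ht))
  have m1 : basicFunctional f (fun _ : Fin 1 => χ) (fun _ => V) ∈ Functionals N s :=
    basic_mem ⟨f, 1, _, _, fun _ => ⟨χ.contDiff, χ.hasCompactSupport⟩, rfl⟩
  have m2 : basicFunctional 0 (fun _ : Fin 1 => χ) (fun _ => V) ∈ Functionals N s :=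
    basic_mem ⟨0, 1, _, _, fun _ => ⟨χ.contDiff, χ.hasCompactSupport⟩, rfl⟩
  have key : actionVariation V x₀ = basicFunctional f (fun _ : Fin 1 => χ) (fun _ => V)
      - shift x₀ (basicFunctional 0 (fun _ : Fin 1 => χ) (fun _ => V))
      + constFunctional N s (∫ t, (1 / 2) * ‖deriv ⇑x₀ t‖ ^ 2) := by
    funext x
    have hx : Continuous ⇑x := (orbit_contDiff x).continuous
    have hx'' : ContDiff ℝ ∞ (deriv ⇑x) := (orbit_contDiff x).deriv'
    have hx' : Continuous (deriv ⇑x) := hx''.continuous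
    have i1 : Integrable fun t => (inner ℝ (deriv ⇑x₀ t) (deriv x t) : ℝ) :=
      (hd1.continuous.inner hx').integrable_of_hasCompactSupport
        (hc1.mono fun t ht h => ht (by simp [h]))
    have i2 : Integrable fun t => (inner ℝ (deriv (deriv ⇑x₀) t) (x t) : ℝ) :=
      (hd2.continuous.inner hx).integrable_of_hasCompactSupport
        (hc2.mono fun t ht h => ht (by simp [h]))
    have i3 : Integrable fun t => (inner ℝ (deriv ⇑x₀ t) (x t) : ℝ) :=
      (hd1.continuous.inner hx).integrable_of_hasCompactSupport
        (hc1.mono fun t ht h => ht (by simp [h]))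
    have i4 : Integrable fun t => (1 / 2) * ‖deriv ⇑x₀ t‖ ^ 2 :=
      (continuous_const.mul (hd1.continuous.norm.pow 2)).integrable_of_hasCompactSupport
        (hc1.mono fun t ht h => ht (by simp [h]))
    have i5 : Integrable fun t => χ t * V (x t) :=
      (χ.continuous.mul (V.continuous.comp hx)).integrable_of_hasCompactSupport
        χ.hasCompactSupport.mul_right
    have hxx : Continuous fun t => x t + x₀ t :=
      hx.add (loop_contDiff x₀).continuous
    have i6 : Integrable fun t => χ t * V (x t + x₀ t) :=
      (χ.continuous.mul (V.continuous.comp hxx)).integrable_of_hasCompactSupport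
        χ.hasCompactSupport.mul_right
    have parts : ∫ t, (inner ℝ (deriv ⇑x₀ t) (deriv x t) : ℝ) =
        - ∫ t, (inner ℝ (deriv (deriv ⇑x₀) t) (x t) : ℝ) := by
      have hu : ∀ t ∈ tsupport ⇑x,
          HasDerivAt (deriv ⇑x₀) (deriv (deriv ⇑x₀) t) t := fun t _ =>
        ((hd1.differentiable (by simp)) t).hasDerivAt
      have hv : ∀ t ∈ tsupport (deriv ⇑x₀), HasDerivAt ⇑x
          (deriv x t) t := fun t _ => orbit_hasDerivAt x t
      exact integral_bilinear_hasDerivAt_right_eq_neg_left_of_integrable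
        (L := innerSL ℝ) hu hv i1 i2 i3
    have hf : ∀ t, f t = - deriv (deriv ⇑x₀) t := fun _ => rfl
    have hxa : ∀ t, (x + (x₀ : Orbit N s)) t =
      x t + x₀ t := fun _ => rfl
    have lhs : actionVariation V x₀ x = ∫ t,
        (inner ℝ (deriv ⇑x₀ t) (deriv x t) + (1 / 2) * ‖deriv ⇑x₀ t‖ ^ 2
          + (χ t * V (x t) - χ t * V (x t + x₀ t))) := by
      refine integral_congr_ae (Filter.Eventually.of_forall fun t => ?_)
      have e : χ t * V (x t) - χ t * V (x t + x₀ t) =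
          V (x t) - V (x t + x₀ t) := by
        by_cases ht : t ∈ tsupport ⇑x₀
        · simp [hχ t ht]
        · simp [image_eq_zero_of_notMem_tsupport ht]
      simp only [e, lagrangean, orbit_deriv_add, hxa, norm_add_sq_real]
      rw [real_inner_comm]
      ring
    have c1 : basicFunctional f (fun _ : Fin 1 => χ) (fun _ => V) x =
        - (∫ t, (inner ℝ (deriv (deriv ⇑x₀) t) (x t) : ℝ))
          + ∫ t, χ t * V (x t) := by
      have i2' : Integrable fun t => -(inner ℝ (deriv (deriv ⇑x₀) t) (x t) : ℝ) := i2.neg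
      rw [← integral_neg, ← integral_add i2' i5]
      simp [basicFunctional, hf, inner_neg_left]
    have c2 : shift x₀ (basicFunctional 0 (fun _ : Fin 1 => χ) (fun _ => V)) x =
        ∫ t, χ t * V (x t + x₀ t) := by
      simp [shift, basicFunctional, hxa]
    have j1 : Integrable fun t => (inner ℝ (deriv ⇑x₀ t) (deriv ⇑x t) : ℝ) +
      (1 / 2) * ‖deriv ⇑x₀ t‖ ^ 2 := i1.add i4
    have j2 : Integrable fun t => χ t * V (x t) - χ t * V (x t + x₀ t) := i5.sub i6
    rw [lhs, integral_add j1 j2, integral_add i1 i4, integral_sub i5 i6, parts]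
    simp only [Pi.add_apply, Pi.sub_apply, c1, c2, constFunctional]
    ring
  rw [key]
  exact add_mem (sub_mem m1 (shift_mem x₀ m2)) (const_mem _)

/-! ### The dynamical group -/

/-- The shift as an operation on `𝓕`. -/
def shiftF (x₀ : Loop N s) (F : Functionals N s) : Functionals N s := ⟨shift x₀ F, shift_mem x₀ F.2⟩

/-- `δL(x₀)` as an element of `𝓕`. -/
def deltaL (V : Config N s →ᵇ ℝ) (x₀ : Loop N s) : Functionals N s :=
  ⟨actionVariation V x₀, actionVariation_mem V x₀⟩

/-- The constant functional as an element of `𝓕`. -/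
def constF (N s : ℕ) (h : ℝ) : Functionals N s := ⟨constFunctional N s h, const_mem h⟩

/-- The relators of the dynamical group: the dynamical relations
`S(F) = S(F^{x₀} + δL(x₀))`, the causal relations
`S(F₁ + F₂ + F₃) = S(F₁ + F₃) S(F₃)⁻¹ S(F₂ + F₃)` for `F₁` in the future of `F₂`, and the
normalization `S(0) = 1`. -/
inductive IsRelator (V : Config N s →ᵇ ℝ) : FreeGroup (Functionals N s) → Prop
  | dynamical (F : Functionals N s) (x₀ : Loop N s) :
      IsRelator V (FreeGroup.of F * (FreeGroup.of (shiftF x₀ F + deltaL V x₀))⁻¹)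
  | causal (F₁ F₂ F₃ : Functionals N s)
      (h : InFuture (F₁ : Orbit N s → ℝ) (F₂ : Orbit N s → ℝ)) :
      IsRelator V (FreeGroup.of (F₁ + F₂ + F₃) *
        (FreeGroup.of (F₁ + F₃) * (FreeGroup.of F₃)⁻¹ * FreeGroup.of (F₂ + F₃))⁻¹)
  | normalization : IsRelator V (FreeGroup.of 0)

/-- The dynamical group `𝒢_L`. -/
abbrev DynGroup (V : Config N s →ᵇ ℝ) : Type := PresentedGroup {r | IsRelator V r}

/-- The generators `S(F)` of the dynamical group. -/
def gen (V : Config N s →ᵇ ℝ) (F : Functionals N s) : DynGroup V := PresentedGroup.of F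

/-! ### The *-algebra of a group -/

section GroupAlgebra

variable (G : Type*) [Group G]

/-- The adjoint `∑ c S ↦ ∑ c̄ S⁻¹` on the group algebra. -/
def groupStar : MonoidAlgebra ℂ G →+ MonoidAlgebra ℂ G :=
  MonoidAlgebra.liftNC
    (((algebraMap ℂ (MonoidAlgebra ℂ G)).comp (starRingEnd ℂ) : ℂ →+* MonoidAlgebra ℂ G) :
      ℂ →+ MonoidAlgebra ℂ G)
    (fun g => MonoidAlgebra.single g⁻¹ 1)

variable {G}

theorem groupStar_single (g : G) (c : ℂ) :
    groupStar G (MonoidAlgebra.single g c) = MonoidAlgebra.single g⁻¹ (starRingEnd ℂ c) := by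
  simp [groupStar, MonoidAlgebra.liftNC_single, MonoidAlgebra.single_mul_single]

instance groupAlgebraStarRing : StarRing (MonoidAlgebra ℂ G) where
  star := groupStar G
  star_involutive := by
    intro a
    have : (groupStar G).comp (groupStar G) = AddMonoidHom.id _ := by
      refine MonoidAlgebra.addMonoidHom_ext fun g c => ?_
      simp [groupStar_single]
    exact DFunLike.congr_fun this a
  star_mul := by
    intro a b
    change groupStar G (a * b) = groupStar G b * groupStar G a
    induction a using MonoidAlgebra.induction_linear with
    | zero => simp
    | add x y hx hy => simp [add_mul, mul_add, hx, hy]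
    | single g c =>
      induction b using MonoidAlgebra.induction_linear with
      | zero => simp
      | add x y hx hy => simp [add_mul, mul_add, hx, hy]
      | single h d =>
        simp [groupStar_single, MonoidAlgebra.single_mul_single, mul_comm]
  star_add := fun a b => (groupStar G).map_add a b

theorem star_single (g : G) (c : ℂ) :
    star (MonoidAlgebra.single g c) = MonoidAlgebra.single g⁻¹ (starRingEnd ℂ c) :=
  groupStar_single g c

instance groupAlgebraStarModule : StarModule ℂ (MonoidAlgebra ℂ G) where
  star_smul := by
    intro c a
    induction a using MonoidAlgebra.induction_linear with
    | zero => simp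
    | add x y hx hy => simp [hx, hy]
    | single g d => simp [star_single, MonoidAlgebra.smul_single]

end GroupAlgebra

/-! ### The C*-algebra of a *-algebra, with the norm given by all states -/

/-- The states on a unital *-algebra: normalized positive linear functionals. -/
structure AlgState (A : Type*) [Ring A] [StarRing A] [Algebra ℂ A] where
  /-- the underlying linear functional -/
  toFun : A →ₗ[ℂ] ℂ
  normalized : toFun 1 = 1
  positive : ∀ a, 0 ≤ toFun (star a * a)

/-- A unital *-algebra which is the linear span of its unitaries. -/
class SpannedByUnitaries (A : Type*) [Ring A] [StarRing A] [Algebra ℂ A] : Prop where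
  span_unitary : Submodule.span ℂ (unitary A : Set A) = ⊤

/-- The norm `‖a‖` given by `‖a‖² = sup ρ(a* a)`, where the supremum extends over all states. -/
def stateNorm {A : Type*} [Ring A] [StarRing A] [Algebra ℂ A] (a : A) : ℝ :=
  Real.sqrt (⨆ ρ : AlgState A, (ρ.toFun (star a * a)).re)

section StateNorm

variable {A : Type*} [Ring A] [StarRing A] [Algebra ℂ A]

theorem stateNorm_nonneg (a : A) : 0 ≤ stateNorm a := Real.sqrt_nonneg _

/-- The seminorm `ρ(a* a)^{1/2}` of a positive functional. -/
def posNorm (φ : A →ₗ[ℂ] ℂ) (a : A) : ℝ := Real.sqrt (φ (star a * a)).re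

theorem posNorm_sq {φ : A →ₗ[ℂ] ℂ} (hφ : ∀ a, 0 ≤ φ (star a * a)) (a : A) :
    posNorm φ a ^ 2 = (φ (star a * a)).re :=
  Real.sq_sqrt (Complex.nonneg_iff.1 (hφ a)).1

theorem posNorm_nonneg (φ : A →ₗ[ℂ] ℂ) (a : A) : 0 ≤ posNorm φ a := Real.sqrt_nonneg _

theorem posNorm_zero (φ : A →ₗ[ℂ] ℂ) : posNorm φ 0 = 0 := by simp [posNorm]

theorem stateNorm_le {a : A} {C : ℝ} (hC : 0 ≤ C) (h : ∀ ρ : AlgState A, posNorm ρ.toFun a ≤ C) :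
    stateNorm a ≤ C := by
  refine Real.sqrt_le_iff.2 ⟨hC, Real.iSup_le (fun ρ => ?_) (sq_nonneg C)⟩
  rw [← posNorm_sq ρ.positive]
  exact pow_le_pow_left₀ (posNorm_nonneg _ _) (h ρ) 2

theorem stateNorm_zero : stateNorm (0 : A) = 0 :=
  le_antisymm (stateNorm_le le_rfl fun _ => (posNorm_zero _).le) (stateNorm_nonneg _)

variable [StarModule ℂ A]

/-- The pre-inner product `⟨a, b⟩ = ρ(a* b)` of a positive functional. -/
abbrev posCore (φ : A →ₗ[ℂ] ℂ) (hφ : ∀ a, 0 ≤ φ (star a * a)) : PreInnerProductSpace.Core ℂ A where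
  inner a b := φ (star a * b)
  conj_inner_symm a b := by
    have h1 := (Complex.nonneg_iff.1 (hφ (a + b))).2
    have h2 := (Complex.nonneg_iff.1 (hφ (a + Complex.I • b))).2
    have ha := (Complex.nonneg_iff.1 (hφ a)).2
    have hb := (Complex.nonneg_iff.1 (hφ b)).2
    simp only [star_add, star_smul, add_mul, mul_add, map_add, smul_mul_assoc, mul_smul_comm,
      map_smul, smul_eq_mul, Complex.add_im, Complex.mul_im, Complex.mul_re, Complex.I_re,
      Complex.I_im, RCLike.star_def, Complex.conj_I, Complex.neg_re, Complex.neg_im] at h1 h2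
    apply Complex.ext
    · simp only [Complex.conj_re]; linarith
    · simp only [Complex.conj_im]; linarith
  re_inner_nonneg a := (Complex.nonneg_iff.1 (hφ a)).1
  add_left a b c := by simp [add_mul]
  smul_left a b r := by simp

theorem posNorm_add_le {φ : A →ₗ[ℂ] ℂ} (hφ : ∀ a, 0 ≤ φ (star a * a)) (a b : A) :
    posNorm φ (a + b) ≤ posNorm φ a + posNorm φ b := by
  let _ := InnerProductSpace.Core.toSeminormedAddCommGroup (c := posCore φ hφ)
  exact norm_add_le a b

theorem posNorm_cauchy {φ : A →ₗ[ℂ] ℂ} (hφ : ∀ a, 0 ≤ φ (star a * a)) (a b : A) :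
    ‖φ (star a * b)‖ ≤ posNorm φ a * posNorm φ b := by
  let _ := posCore φ hφ
  exact InnerProductSpace.Core.norm_inner_le_norm (𝕜 := ℂ) a b

theorem posNorm_smul (φ : A →ₗ[ℂ] ℂ) (c : ℂ) (a : A) :
    posNorm φ (c • a) = ‖c‖ * posNorm φ a := by
  have : star (c • a) * (c • a) = ((‖c‖ ^ 2 : ℝ) : ℂ) • (star a * a) := by
    rw [star_smul, smul_mul_smul_comm, RCLike.star_def, Complex.conj_mul']
    norm_cast
  rw [posNorm, posNorm, this, map_smul, smul_eq_mul, Complex.re_ofReal_mul,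
    Real.sqrt_mul (sq_nonneg _), Real.sqrt_sq (norm_nonneg _)]

variable [SpannedByUnitaries A]

theorem posNorm_bounded (a : A) : ∃ C : ℝ, ∀ ρ : AlgState A, posNorm ρ.toFun a ≤ C := by
  have ha : a ∈ Submodule.span ℂ (unitary A : Set A) := by
    rw [SpannedByUnitaries.span_unitary]; trivial
  induction ha using Submodule.span_induction with
  | mem u hu =>
    refine ⟨1, fun ρ => ?_⟩
    rw [posNorm, (Unitary.mem_iff.1 hu).1, ρ.normalized]
    simp
  | zero => exact ⟨0, fun _ => (posNorm_zero _).le⟩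
  | add x y _ _ hx hy =>
    obtain ⟨C, hC⟩ := hx
    obtain ⟨D, hD⟩ := hy
    exact ⟨C + D, fun ρ => (posNorm_add_le ρ.positive x y).trans (add_le_add (hC ρ) (hD ρ))⟩
  | smul c x _ hx =>
    obtain ⟨C, hC⟩ := hx
    refine ⟨‖c‖ * C, fun ρ => ?_⟩
    rw [posNorm_smul]
    exact mul_le_mul_of_nonneg_left (hC ρ) (norm_nonneg _)

theorem posNorm_le_stateNorm (ρ : AlgState A) (a : A) : posNorm ρ.toFun a ≤ stateNorm a := by
  refine Real.sqrt_le_sqrt (le_ciSup (f := fun ρ : AlgState A => (ρ.toFun (star a * a)).re) ?_ ρ)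
  obtain ⟨C, hC⟩ := posNorm_bounded a
  refine ⟨C ^ 2, ?_⟩
  rintro _ ⟨ρ, rfl⟩
  change (ρ.toFun (star a * a)).re ≤ C ^ 2
  rw [← posNorm_sq ρ.positive]
  exact pow_le_pow_left₀ (posNorm_nonneg _ _) (hC ρ) 2

theorem stateNorm_add_le (a b : A) : stateNorm (a + b) ≤ stateNorm a + stateNorm b :=
  stateNorm_le (add_nonneg (stateNorm_nonneg a) (stateNorm_nonneg b)) fun ρ =>
    (posNorm_add_le ρ.positive a b).trans
      (add_le_add (posNorm_le_stateNorm ρ a) (posNorm_le_stateNorm ρ b))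

theorem stateNorm_smul_le (c : ℂ) (a : A) : stateNorm (c • a) ≤ ‖c‖ * stateNorm a :=
  stateNorm_le (mul_nonneg (norm_nonneg c) (stateNorm_nonneg a)) fun ρ => by
    rw [posNorm_smul]
    exact mul_le_mul_of_nonneg_left (posNorm_le_stateNorm ρ a) (norm_nonneg _)

theorem posNorm_mul_le (ρ : AlgState A) (a b : A) :
    posNorm ρ.toFun (a * b) ≤ stateNorm a * posNorm ρ.toFun b := by
  have hassoc : star (a * b) * (a * b) = star b * (star a * (a * b)) := by
    rw [star_mul, mul_assoc]
  by_cases hb : posNorm ρ.toFun b = 0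
  · have h := posNorm_cauchy ρ.positive b (star a * (a * b))
    rw [hb, zero_mul, ← hassoc] at h
    have h' : ρ.toFun (star (a * b) * (a * b)) = 0 := norm_le_zero_iff.1 h
    rw [hb, mul_zero, posNorm, h']
    simp
  · have hpos : 0 < posNorm ρ.toFun b := lt_of_le_of_ne (posNorm_nonneg _ _) (Ne.symm hb)
    have hval : ρ.toFun (star b * b) = ((posNorm ρ.toFun b ^ 2 : ℝ) : ℂ) := by
      rw [posNorm_sq ρ.positive]
      apply Complex.ext
      · simp
      · simpa using (Complex.nonneg_iff.1 (ρ.positive b)).2.symm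
    have hne : ((posNorm ρ.toFun b ^ 2 : ℝ) : ℂ) ≠ 0 := by exact_mod_cast (pow_pos hpos 2).ne'
    let ρ' : AlgState A :=
      { toFun := ((posNorm ρ.toFun b ^ 2 : ℝ) : ℂ)⁻¹ •
          (ρ.toFun ∘ₗ LinearMap.mulLeft ℂ (star b) ∘ₗ LinearMap.mulRight ℂ b)
        normalized := by simp [hval] at hne ⊢; field_simp
        positive := fun x => by
          have h1 : star b * ((star x * x) * b) = star (x * b) * (x * b) := by
            rw [star_mul]; simp only [mul_assoc]
          have h2 : (0 : ℂ) ≤ ((posNorm ρ.toFun b ^ 2 : ℝ) : ℂ)⁻¹ := by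
            rw [← Complex.ofReal_inv]
            exact_mod_cast inv_nonneg.2 (sq_nonneg _)
          simp only [LinearMap.smul_apply, LinearMap.comp_apply, LinearMap.mulLeft_apply,
            LinearMap.mulRight_apply, smul_eq_mul, h1]
          exact mul_nonneg h2 (ρ.positive _) }
    have h := pow_le_pow_left₀ (posNorm_nonneg _ _) (posNorm_le_stateNorm ρ' a) 2
    rw [posNorm_sq ρ'.positive] at h
    have h3 : (ρ'.toFun (star a * a)).re = (posNorm ρ.toFun b ^ 2)⁻¹ * posNorm ρ.toFun (a * b) ^ 2 := by
      have h1 : star b * ((star a * a) * b) = star (a * b) * (a * b) := by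
        rw [star_mul]; simp only [mul_assoc]
      simp only [ρ', LinearMap.smul_apply, LinearMap.comp_apply, LinearMap.mulLeft_apply,
            LinearMap.mulRight_apply, smul_eq_mul, h1]
      rw [← Complex.ofReal_inv, Complex.re_ofReal_mul, posNorm_sq ρ.positive,
        posNorm_sq ρ.positive (a * b)]
    rw [h3, inv_mul_le_iff₀ (pow_pos hpos 2), mul_comm, ← mul_pow] at h
    exact le_of_sq_le_sq h (mul_nonneg (stateNorm_nonneg a) hpos.le)

theorem stateNorm_mul_le (a b : A) : stateNorm (a * b) ≤ stateNorm a * stateNorm b :=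
  stateNorm_le (mul_nonneg (stateNorm_nonneg a) (stateNorm_nonneg b)) fun ρ =>
    (posNorm_mul_le ρ a b).trans
      (mul_le_mul_of_nonneg_left (posNorm_le_stateNorm ρ b) (stateNorm_nonneg a))

theorem stateNorm_mul_self_le (a : A) : stateNorm a * stateNorm a ≤ stateNorm (star a * a) := by
  have h : stateNorm a ≤ Real.sqrt (stateNorm (star a * a)) := by
    refine stateNorm_le (Real.sqrt_nonneg _) fun ρ => Real.sqrt_le_sqrt ?_
    have h1 := posNorm_cauchy ρ.positive 1 (star a * a)
    have h2 : posNorm ρ.toFun 1 = 1 := by simp [posNorm, ρ.normalized]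
    rw [h2, one_mul, star_one, one_mul] at h1
    exact (Complex.re_le_norm _).trans (h1.trans (posNorm_le_stateNorm ρ _))
  calc stateNorm a * stateNorm a
      ≤ Real.sqrt (stateNorm (star a * a)) * Real.sqrt (stateNorm (star a * a)) :=
        mul_self_le_mul_self (stateNorm_nonneg a) h
    _ = _ := Real.mul_self_sqrt (stateNorm_nonneg _)

theorem stateNorm_star_le (a : A) : stateNorm (star a) ≤ stateNorm a := by
  have h := (stateNorm_mul_self_le (star a)).trans (stateNorm_mul_le _ _)
  rw [star_star] at h
  by_contra! hlt
  nlinarith [stateNorm_nonneg a]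

variable (A)

/-- The norm of `stateNorm`, as a ring seminorm. -/
def stateRingSeminorm : RingSeminorm A where
  toFun := stateNorm
  map_zero' := stateNorm_zero
  add_le' := stateNorm_add_le
  neg' a := by simp [stateNorm]
  mul_le' := stateNorm_mul_le

/-- A copy of `A`, which carries the norm `stateNorm`. -/
def StateNormed (A : Type*) : Type _ := A

instance : SeminormedRing (StateNormed A) := (stateRingSeminorm A).toSeminormedRing

instance : StarRing (StateNormed A) := inferInstanceAs (StarRing A)

instance : Algebra ℂ (StateNormed A) := inferInstanceAs (Algebra ℂ A)

instance : StarModule ℂ (StateNormed A) := inferInstanceAs (StarModule ℂ A)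

instance : NormedAlgebra ℂ (StateNormed A) where
  norm_smul_le c a := stateNorm_smul_le (A := A) c a

variable {A}

theorem norm_mul_self_le_star_mul (a : StateNormed A) : ‖a‖ * ‖a‖ ≤ ‖star a * a‖ :=
  stateNorm_mul_self_le (A := A) a

theorem norm_star_le_norm (a : StateNormed A) : ‖star a‖ ≤ ‖a‖ := stateNorm_star_le (A := A) a

theorem isometry_star : Isometry (star : StateNormed A → StateNormed A) := by
  refine AddMonoidHomClass.isometry_of_norm (starAddEquiv : StateNormed A ≃+ StateNormed A)
    fun a => le_antisymm (norm_star_le_norm a) ?_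
  have := norm_star_le_norm (star a)
  rwa [star_star] at this

variable (A)

/-- The C*-algebra of `A`: the completion of `A` with respect to the norm `stateNorm`. -/
def CStarCompletion : Type _ := UniformSpace.Completion (StateNormed A)

namespace CStarCompletion

instance : NormedRing (CStarCompletion A) :=
  inferInstanceAs (NormedRing (UniformSpace.Completion (StateNormed A)))

instance : CompleteSpace (CStarCompletion A) :=
  inferInstanceAs (CompleteSpace (UniformSpace.Completion (StateNormed A)))

instance : Algebra ℂ (CStarCompletion A) :=
  inferInstanceAs (Algebra ℂ (UniformSpace.Completion (StateNormed A)))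

instance : NormedAlgebra ℂ (CStarCompletion A) where
  norm_smul_le c a :=
    (norm_smul_le c (show UniformSpace.Completion (StateNormed A) from a) :)

/-- The canonical map to the completion. -/
def of (a : StateNormed A) : CStarCompletion A := (a : UniformSpace.Completion (StateNormed A))

variable {A}

theorem continuous_of : Continuous (of A) := UniformSpace.Completion.continuous_coe _

theorem induction_of {p : CStarCompletion A → Prop} (hp : IsClosed {a | p a})
    (h : ∀ a, p (of A a)) (a : CStarCompletion A) : p a :=
  UniformSpace.Completion.induction_on a hp h

theorem of_add (a b : StateNormed A) : of A (a + b) = of A a + of A b :=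
  UniformSpace.Completion.coe_add a b

theorem of_mul (a b : StateNormed A) : of A (a * b) = of A a * of A b :=
  UniformSpace.Completion.coe_mul a b

theorem of_smul (c : ℂ) (a : StateNormed A) : of A (c • a) = c • of A a :=
  UniformSpace.Completion.coe_smul c a

theorem norm_of (a : StateNormed A) : ‖of A a‖ = ‖a‖ := UniformSpace.Completion.norm_coe a

/-- The continuous extension of the adjoint to the completion. -/
instance : Star (CStarCompletion A) where
  star := UniformSpace.Completion.map (star : StateNormed A → StateNormed A)

theorem continuous_star' : Continuous (star : CStarCompletion A → CStarCompletion A) :=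
  UniformSpace.Completion.continuous_map

theorem star_of (a : StateNormed A) : star (of A a) = of A (star a) :=
  UniformSpace.Completion.map_coe isometry_star.uniformContinuous a

instance : StarRing (CStarCompletion A) where
  star_involutive a := by
    induction a using induction_of with
    | hp => exact isClosed_eq (continuous_star'.comp continuous_star') continuous_id
    | h a => rw [star_of, star_of, star_star]
  star_mul a b := by
    induction a using induction_of with
    | hp =>
        exact isClosed_eq (continuous_star'.comp (continuous_mul_const b))
          (continuous_const.mul continuous_star')
    | h a =>
      induction b using induction_of with
      | hp =>
        exact isClosed_eq (continuous_star'.comp (continuous_const_mul _))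
          (continuous_star'.mul continuous_const)
      | h b => rw [star_of, star_of, ← of_mul, ← of_mul, star_of, star_mul]
  star_add a b := by
    induction a using induction_of with
    | hp =>
        exact isClosed_eq (continuous_star'.comp (continuous_add_const b))
          (continuous_star'.add continuous_const)
    | h a =>
      induction b using induction_of with
      | hp =>
        exact isClosed_eq (continuous_star'.comp (continuous_const_add _))
          (continuous_const.add continuous_star')
      | h b => rw [star_of, star_of, ← of_add, ← of_add, star_of, star_add]

instance : StarModule ℂ (CStarCompletion A) where
  star_smul c a := by
    induction a using induction_of with
    | hp =>
        exact isClosed_eq (continuous_star'.comp (continuous_const_smul c))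
          (continuous_star'.const_smul (star c))
    | h a => rw [star_of, ← of_smul, ← of_smul, star_of, star_smul]

instance : CStarRing (CStarCompletion A) where
  norm_mul_self_le a := by
    induction a using induction_of with
    | hp =>
        exact isClosed_le (continuous_norm.mul continuous_norm)
          (continuous_norm.comp (continuous_star'.mul continuous_id))
    | h a =>
      rw [star_of, ← of_mul, norm_of, norm_of]
      exact norm_mul_self_le_star_mul a

instance : CStarAlgebra (CStarCompletion A) where

end CStarCompletion

end StateNorm

/-! ### The dynamical algebra -/

section Algebra

variable (V : Config N s →ᵇ ℝ)

/-- The element of the group algebra of `𝒢_L` given by a group element. -/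
abbrev groupElt (S : DynGroup V) : MonoidAlgebra ℂ (DynGroup V) := MonoidAlgebra.single S 1

/-- The relations `S(F_h) = e^{ih} 1` for the constant functionals `F_h`, together with their
adjoints `S(F_h)⁻¹ = e^{-ih} 1`. -/
inductive ConstRel : MonoidAlgebra ℂ (DynGroup V) → MonoidAlgebra ℂ (DynGroup V) → Prop
  | const (h : ℝ) : ConstRel (groupElt V (gen V (constF N s h)))
      (Complex.exp (Complex.I * h) • (1 : MonoidAlgebra ℂ (DynGroup V)))
  | const_adjoint (h : ℝ) : ConstRel (groupElt V (gen V (constF N s h))⁻¹)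
      (Complex.exp (-(Complex.I * h)) • (1 : MonoidAlgebra ℂ (DynGroup V)))

theorem ConstRel.star_rel (a b : MonoidAlgebra ℂ (DynGroup V)) (h : ConstRel V a b) :
    ConstRel V (star a) (star b) := by
  cases h with
  | const h =>
    convert ConstRel.const_adjoint h using 1
    · simp [star_single]
    · simp [star_smul, ← Complex.exp_conj]
  | const_adjoint h =>
    convert ConstRel.const h using 1
    · simp [star_single]
    · simp [star_smul, ← Complex.exp_conj]

/-- The *-algebra spanned by the dynamical group: the group algebra of `𝒢_L` over `ℂ`, in which the
elements for the constant functionals are fixed by `S(F_h) = e^{ih} 1`. -/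
abbrev PreAlgebra : Type := RingQuot (ConstRel V)

instance : StarRing (PreAlgebra V) := RingQuot.starRing (ConstRel V) (ConstRel.star_rel V)

/-- The quotient map from the group algebra. -/
abbrev toPreAlgebra : MonoidAlgebra ℂ (DynGroup V) →ₐ[ℂ] PreAlgebra V :=
  RingQuot.mkAlgHom ℂ (ConstRel V)

theorem star_toPreAlgebra (a : MonoidAlgebra ℂ (DynGroup V)) :
    star (toPreAlgebra V a) = toPreAlgebra V (star a) := by
  simp only [toPreAlgebra, RingQuot.mkAlgHom_def, RingQuot.mkRingHom_def]
  rfl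

instance : StarModule ℂ (PreAlgebra V) where
  star_smul c a := by
    obtain ⟨a, rfl⟩ := RingQuot.mkAlgHom_surjective ℂ (ConstRel V) a
    rw [← map_smul, star_toPreAlgebra, star_toPreAlgebra, star_smul, map_smul]

instance : SpannedByUnitaries (PreAlgebra V) where
  span_unitary := by
    refine eq_top_iff.2 fun a _ => ?_
    obtain ⟨a, rfl⟩ := RingQuot.mkAlgHom_surjective ℂ (ConstRel V) a
    induction a using MonoidAlgebra.induction_linear with
    | zero => rw [map_zero]; exact zero_mem _
    | add x y hx hy => rw [map_add]; exact add_mem (hx trivial) (hy trivial)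
    | single g c =>
      have h1 : MonoidAlgebra.single g c = c • groupElt V g := by simp
      rw [h1, map_smul]
      refine Submodule.smul_mem _ _ (Submodule.subset_span (Unitary.mem_iff.2 ⟨?_, ?_⟩)) <;>
      · rw [star_toPreAlgebra, ← map_mul]
        simp [star_single, MonoidAlgebra.single_mul_single, ← MonoidAlgebra.one_def]

/-- The dynamical C*-algebra `𝒜_L` of the Lagrangean `L = ẋ²/2 - V`: the completion of the
*-algebra spanned by the dynamical group with respect to the norm
`‖A‖² = sup ρ(A* A)`, the supremum extending over all states `ρ`. -/
abbrev DynamicalAlgebra : Type := CStarCompletion (PreAlgebra V)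

/-- The unitaries `S(F)` in the dynamical algebra. -/
def genUnitary (F : Functionals N s) : DynamicalAlgebra V :=
  CStarCompletion.of (PreAlgebra V) (toPreAlgebra V (groupElt V (gen V F)))

end Algebra

/-! ### Representations and states -/

section Representation

variable {A : Type*} [CStarAlgebra A] {H : Type*} [NormedAddCommGroup H] [InnerProductSpace ℂ H]
  [CompleteSpace H]

/-- A representation `π` is irreducible if `π(A)'' = B(H)`. -/
def IsIrreducibleRep (π : A →⋆ₐ[ℂ] (H →L[ℂ] H)) : Prop :=
  Set.centralizer (Set.centralizer (Set.range π)) = Set.univ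

/-- The closure of `π(A)` in the weak operator topology. -/
def weakClosure (π : A →⋆ₐ[ℂ] (H →L[ℂ] H)) : Set (H →L[ℂ] H) :=
  {X | (ContinuousLinearMapWOT.ofCLM X : H →WOT[ℂ] H) ∈
    closure (Set.range fun a => (ContinuousLinearMapWOT.ofCLM (π a) : H →WOT[ℂ] H))}

/-- The vector functional `X ↦ ⟨Ω, X Ω⟩` on operators. For `‖Ω‖ = 1` it is the extension to the weak
closure of the vector state `a ↦ ⟨Ω, π(a) Ω⟩`. -/
def vectorState (Ω : H) : (H →L[ℂ] H) →ₗ[ℂ] ℂ where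
  toFun X := inner ℂ Ω (X Ω)
  map_add' X Y := by simp
  map_smul' c X := by simp

/-- The image of the vector state of `Ω` under the operation `S`, i.e. its composition with
`Ad S⁻¹`, extended to the weak closure; here `S` is unitary, so that `S⁻¹ = S*`. -/
def transformedState (π : A →⋆ₐ[ℂ] (H →L[ℂ] H)) (Ω : H) (S : A) : (H →L[ℂ] H) →ₗ[ℂ] ℂ where
  toFun X := vectorState Ω (star (π S) * X * π S)
  map_add' X Y := by simp [mul_add, add_mul]
  map_smul' c X := by simp

/-- The transformed state is the vector state of `π(S) Ω`. -/
theorem transformedState_apply (π : A →⋆ₐ[ℂ] (H →L[ℂ] H)) (Ω : H) (S : A) (X : H →L[ℂ] H) :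
    transformedState π Ω S X = vectorState (π S Ω) X := by
  simp [transformedState, vectorState, ContinuousLinearMap.star_eq_adjoint,
    ContinuousLinearMap.adjoint_inner_right]

/-- The transition probability `|ω(S)|²` between the vector state `ω` of `Ω` and its image under the
operation `S`. -/
def transitionProbability (π : A →⋆ₐ[ℂ] (H →L[ℂ] H)) (Ω : H) (S : A) : ℝ :=
  ‖vectorState Ω (π S)‖ ^ 2

end Representation

end DynAlg

end

/-! Suppose some `U` maps `HN` isometrically into the range of `E` with `⟨x, U x⟩ = ⟨x, E x⟩`. A
unitary `S` acting on `HN` exactly as `±U` would give `ω_S(1 - E) = 0` and `|ω(S)|² = ω(E)²`. Such a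
`U` exists because the range of `E` is infinite dimensional: put `U x = E x + J ((1 - E) x)`, with
`J` an isometry from `(1 - E) HN` into the part of the range orthogonal to `E HN`
(`exists_linearIsometry_into_range`).

It remains to approximate an isometry `W` of a finite dimensional `K` by unitaries of the algebra,
as in Kadison transitivity; this holds for any irreducibly represented unital C*-algebra. The Cayley
transform turns the task into one about self-adjoint operators. If `1 - W` is injective, then `i(1 +
W)(1 - W)⁻¹` is symmetric on a finite dimensional space and extends to a bounded self-adjoint `X`
(`exists_isSelfAdjoint_cayley`). Irreducibility yields self-adjoint `a` in the algebra with `π a`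
close to `X` on finitely many vectors (`mem_closure_range_selfAdjoint`), and `u = (a - i)(a + i)⁻¹`
is a unitary of the algebra. The error of `π u` against `W` is controlled by that of `π a` against
`X` on these vectors alone, whatever the norm of `a` (`exists_unitary_approx`). The bound is uniform
on the unit sphere of `K`, so one unitary serves all vectors.

Injectivity of `1 - W` is secured by taking `W = -U`; the sign disappears in the states and in
`|ω(S)|²`. -/

noncomputable section

namespace DynAlg

/-! ### Density of the algebra on finite families of vectors, and the Cayley transform in a
C*-algebra -/

section Density

variable {A : Type*} [CStarAlgebra A] {H : Type*} [NormedAddCommGroup H] [InnerProductSpace ℂ H]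
  [CompleteSpace H] {ι : Type*} [Fintype ι]

/-- The componentwise action of an operator on a finite direct sum of Hilbert spaces. -/
def piLpDiag (ι : Type*) [Fintype ι] (T : H →L[ℂ] H) :
    PiLp 2 (fun _ : ι => H) →L[ℂ] PiLp 2 (fun _ : ι => H) :=
  ((PiLp.continuousLinearEquiv 2 ℂ (fun _ : ι => H)).symm :
      (ι → H) →L[ℂ] PiLp 2 (fun _ : ι => H)) ∘L
    ContinuousLinearMap.pi fun i => T ∘L PiLp.proj 2 (fun _ : ι => H) i

omit [CompleteSpace H] in
@[simp]
theorem piLpDiag_apply (T : H →L[ℂ] H) (v : PiLp 2 (fun _ : ι => H)) (i : ι) :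
    piLpDiag ι T v i = T (v i) := rfl

theorem inner_piLpDiag_right (T : H →L[ℂ] H) (v w : PiLp 2 (fun _ : ι => H)) :
    inner ℂ v (piLpDiag ι T w) = inner ℂ (piLpDiag ι (star T) v) w := by
  simp [PiLp.inner_apply, ContinuousLinearMap.star_eq_adjoint,
    ContinuousLinearMap.adjoint_inner_left]

omit [CompleteSpace H] in
/-- An operator which commutes with all matrix entries of an operator on a finite direct sum
commutes with that operator. -/
theorem commute_piLpDiag_of_entries [DecidableEq ι] (X : H →L[ℂ] H)
    (P : PiLp 2 (fun _ : ι => H) →L[ℂ] PiLp 2 (fun _ : ι => H))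
    (h : ∀ i j (x : H), X (P (PiLp.single 2 j x) i) = P (PiLp.single 2 j (X x)) i)
    (v : PiLp 2 (fun _ : ι => H)) : P (piLpDiag ι X v) = piLpDiag ι X (P v) := by
  have hsum : ∀ w : PiLp 2 (fun _ : ι => H), w = ∑ j, PiLp.single 2 j (w j) := by
    intro w
    ext i
    simp [Pi.single_apply]
  ext i
  conv_lhs => rw [hsum (piLpDiag ι X v)]
  conv_rhs => rw [hsum v]
  simp [map_sum, h]

/-- The density part of the double commutant theorem for finite families of vectors. -/
theorem mem_closure_range_of_isIrreducibleRep {π : A →⋆ₐ[ℂ] (H →L[ℂ] H)}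
    (hπ : IsIrreducibleRep π) (X : H →L[ℂ] H) (ξ : ι → H) :
    (fun i => X (ξ i)) ∈ closure (Set.range fun (b : A) (i : ι) => π b (ξ i)) := by
  classical
  let ξ' : PiLp 2 (fun _ : ι => H) := WithLp.toLp 2 ξ
  let orb : A →ₗ[ℂ] PiLp 2 (fun _ : ι => H) :=
    { toFun := fun b => piLpDiag ι (π b) ξ'
      map_add' := fun b c => by ext i; simp
      map_smul' := fun c b => by ext i; simp }
  -- The closed cyclic subspace of `ξ` under the diagonal action on the direct sum; the claim is
  -- that it contains the diagonal image of `ξ` under `X`.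
  let M : Submodule ℂ (PiLp 2 (fun _ : ι => H)) := (LinearMap.range orb).topologicalClosure
  have hMc : IsClosed (M : Set (PiLp 2 (fun _ : ι => H))) :=
    Submodule.isClosed_topologicalClosure _
  have : CompleteSpace M := hMc.completeSpace_coe
  have hinv : ∀ b : A, ∀ v ∈ M, piLpDiag ι (π b) v ∈ M := by
    intro b v hv
    refine map_mem_closure (piLpDiag ι (π b)).continuous hv ?_
    rintro _ ⟨c, rfl⟩
    exact ⟨b * c, by ext i; simp [orb]⟩
  have hcomm : ∀ (b : A) (v : PiLp 2 (fun _ : ι => H)),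
      M.starProjection (piLpDiag ι (π b) v) = piLpDiag ι (π b) (M.starProjection v) := by
    intro b v
    -- `M` is invariant under `π b` and under its adjoint `π (star b)`, so its orthogonal complement
    -- is invariant as well.
    refine Submodule.eq_starProjection_of_mem_of_inner_eq_zero
      (hinv b _ (M.starProjection_apply_mem v)) fun w hw => ?_
    rw [← map_sub, ← inner_conj_symm, inner_piLpDiag_right, ← map_star, inner_conj_symm]
    exact M.starProjection_inner_eq_zero v _ (hinv _ w hw)
  have hξ : ξ' ∈ M := Submodule.le_topologicalClosure _ ⟨1, by ext i; simp [orb]⟩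
  have hX : ∀ v, M.starProjection (piLpDiag ι X v) = piLpDiag ι X (M.starProjection v) := by
    refine commute_piLpDiag_of_entries X _ fun i j x => ?_
    -- The `(i, j)` matrix entry of the projection onto `M`. It lies in the commutant of `π`, so the
    -- bicommutant element `X` commutes with it.
    let Q : H →L[ℂ] H := PiLp.proj 2 (fun _ : ι => H) i ∘L M.starProjection ∘L
      ((PiLp.continuousLinearEquiv 2 ℂ (fun _ : ι => H)).symm :
        (ι → H) →L[ℂ] PiLp 2 (fun _ : ι => H)) ∘L ContinuousLinearMap.single ℂ (fun _ : ι => H) j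
    have hQ : Q ∈ Set.centralizer (Set.range π) := by
      rintro _ ⟨b, rfl⟩
      ext y
      have e : piLpDiag ι (π b) (PiLp.single 2 j y) = PiLp.single 2 j (π b y) := by
        ext k
        by_cases hk : k = j
        · subst hk; simp
        · simp [hk]
      have := congrArg (fun v : PiLp 2 (fun _ : ι => H) => v i) (hcomm b (PiLp.single 2 j y))
      rw [e] at this
      exact this.symm
    have hX : X ∈ Set.centralizer (Set.centralizer (Set.range π)) := by
      rw [show _ = Set.univ from hπ]; trivial
    exact (DFunLike.congr_fun (hX Q hQ) x).symm
  have hmem : piLpDiag ι X ξ' ∈ M := by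
    rw [← Submodule.starProjection_eq_self_iff.2 hξ, ← hX]
    exact M.starProjection_apply_mem _
  refine map_mem_closure (PiLp.continuous_ofLp 2 (fun _ : ι => H)) hmem ?_
  rintro _ ⟨b, rfl⟩
  exact ⟨b, rfl⟩

/-- A vector of a finite power of a real Hilbert space is in the closure of the range of a linear map
if it is orthogonal to the orthogonal complement of the range. -/
theorem mem_closure_range_of_inner_eq_zero {B G : Type*} [AddCommGroup B] [Module ℝ B]
    [NormedAddCommGroup G] [InnerProductSpace ℝ G] [CompleteSpace G] (f : B →ₗ[ℝ] ι → G)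
    (x : ι → G) (h : ∀ w : ι → G, (∀ b, ∑ i, inner ℝ (w i) (f b i) = 0) →
      ∑ i, inner ℝ (w i) (x i) = 0) : x ∈ closure (Set.range f) := by
  -- The `ℓ²` direct sum supplies the Hilbert space structure, in which the closure of a subspace is
  -- its double orthogonal complement; the topology is that of `ι → G`.
  let f' : B →ₗ[ℝ] PiLp 2 (fun _ : ι => G) := (WithLp.linearEquiv 2 ℝ (ι → G)).symm.toLinearMap ∘ₗ f
  have hmem : WithLp.toLp 2 x ∈ (LinearMap.range f').topologicalClosure := by
    rw [← Submodule.orthogonal_orthogonal_eq_closure, Submodule.mem_orthogonal]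
    intro w hw
    have hw' : ∀ b, ∑ i, inner ℝ (w i) (f b i) = 0 := fun b => by
      simpa [PiLp.inner_apply, f'] using (Submodule.mem_orthogonal' _ _).1 hw (f' b) ⟨b, rfl⟩
    simpa [PiLp.inner_apply] using h w.ofLp hw'
  refine map_mem_closure (PiLp.continuous_ofLp 2 (fun _ : ι => G)) hmem ?_
  rintro _ ⟨b, rfl⟩
  exact ⟨b, rfl⟩

/-- In an irreducible representation a self-adjoint operator is approximated on finite families of
vectors by self-adjoint elements of the algebra. -/
theorem mem_closure_range_selfAdjoint {π : A →⋆ₐ[ℂ] (H →L[ℂ] H)}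
    (hπ : IsIrreducibleRep π) {X : H →L[ℂ] H} (hX : IsSelfAdjoint X) (ζ : ι → H) :
    (fun i => X (ζ i)) ∈ closure (Set.range fun (a : selfAdjoint A) (i : ι) => π a (ζ i)) := by
  -- The self-adjoint elements form only a real vector space, so orthogonality is taken with respect
  -- to `Re ⟨·, ·⟩`.
  let _ : InnerProductSpace ℝ H := InnerProductSpace.complexToReal
  let orb : selfAdjoint A →ₗ[ℝ] ι → H :=
    { toFun := fun b i => π b (ζ i)
      map_add' := fun b c => by ext i; simp
      map_smul' := fun c b => by
        ext i
        have : ((c • b : selfAdjoint A) : A) = (c : ℂ) • (b : A) := by simp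
        change π ((c • b : selfAdjoint A) : A) (ζ i) = c • π b (ζ i)
        rw [this, map_smul]
        simp }
  refine mem_closure_range_of_inner_eq_zero (B := selfAdjoint A) (G := H) orb _ fun w hw => ?_
  have hw' : ∀ a : selfAdjoint A, ∑ i, (inner ℂ (w i) (π a (ζ i))).re = 0 := hw
  -- The density statement is applied to the doubled family `(ζ, w)`. Then `b ζ` and `b w` are
  -- controlled together, and with the latter also `star b` paired with `w` and `ζ`.
  let f : (ι ⊕ ι → H) → ℝ := fun v =>
    ∑ i, ((inner ℂ (w i) (v (.inl i))).re + (inner ℂ (v (.inr i)) (ζ i)).re)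
  have hf : Continuous f := by
    refine continuous_finsetSum _ fun i _ => ?_
    exact (Complex.continuous_re.comp (continuous_const.inner (continuous_apply _))).add
      (Complex.continuous_re.comp ((continuous_apply _).inner continuous_const))
  have h0 : f (fun i => X (Sum.elim ζ w i)) = 0 := by
    refine (isClosed_eq hf continuous_const).closure_subset_iff.2 ?_
      (mem_closure_range_of_isIrreducibleRep hπ X (Sum.elim ζ w))
    rintro _ ⟨b, rfl⟩
    -- Orthogonality of `w` to `(b + b*) ζ`, with `b*` moved to the other side of the inner product,
    -- says that `f` vanishes on the orbit of `b`.
    have := hw' ⟨b + star b, IsSelfAdjoint.add_star_self b⟩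
    simpa [f, inner_add_right, map_star, ContinuousLinearMap.star_eq_adjoint,
      ContinuousLinearMap.adjoint_inner_right] using this
  have hsymm : ∀ x y, inner ℂ (X x) y = inner ℂ x (X y) := fun x y => by
    conv_lhs => rw [← hX.star_eq]
    rw [ContinuousLinearMap.star_eq_adjoint, ContinuousLinearMap.adjoint_inner_left]
  have h1 : ∑ i, (inner ℂ (w i) (X (ζ i))).re = 0 := by
    simp only [f, Sum.elim_inl, Sum.elim_inr, hsymm, ← two_mul, ← Finset.mul_sum] at h0
    linarith
  exact h1

/-- The Cayley transform: for self-adjoint `a` there is a unitary `u` with `u (a + i) = a - i`. -/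
theorem exists_unitary_mul_add_I {a : A} (ha : IsSelfAdjoint a) :
    ∃ u ∈ unitary A, u * (a + algebraMap ℂ A Complex.I) = a - algebraMap ℂ A Complex.I := by
  -- The spectrum of a self-adjoint element is real, so both `a + i` and `a - i` are invertible.
  have hunit : ∀ z : ℂ, z.im ≠ 0 → IsUnit (a - algebraMap ℂ A z) := by
    intro z hz
    by_contra h
    have hz' : z ∈ spectrum ℂ a := by
      rw [spectrum.mem_iff]
      intro h'
      exact h (by simpa using h'.neg)
    exact hz (ha.im_eq_zero_of_mem_spectrum hz')
  obtain ⟨p, hp⟩ : IsUnit (a + algebraMap ℂ A Complex.I) := by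
    simpa using hunit (-Complex.I) (by simp)
  obtain ⟨m, hm⟩ : IsUnit (a - algebraMap ℂ A Complex.I) := hunit Complex.I (by simp)
  have hpm : star p = m := Units.ext <| by
    rw [Units.coe_star, hp, hm, star_add, ha.star_eq, ← algebraMap_star_comm]
    simp [sub_eq_add_neg]
  have hmp : star m = p := by rw [← hpm, star_star]
  have hc : Commute m p := Units.ext <| by
    rw [Units.val_mul, Units.val_mul, hp, hm]
    have := Algebra.commutes Complex.I a
    rw [sub_mul, mul_add, mul_add, add_mul, mul_sub, mul_sub, this]
    abel
  -- `u = (a - i)(a + i)⁻¹`; it is unitary because its factors commute and the adjoint exchanges `a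
  -- + i` and `a - i`.
  refine ⟨((m * p⁻¹ : Aˣ) : A), ?_, ?_⟩
  · have hs : star (m * p⁻¹) = m⁻¹ * p := by rw [star_mul, star_inv, hpm, hmp]
    rw [Unitary.mem_iff, ← Units.coe_star, hs, ← Units.val_mul, ← Units.val_mul]
    constructor
    · rw [show m⁻¹ * p * (m * p⁻¹) = m⁻¹ * (p * m) * p⁻¹ by group, ← hc.eq]
      simp
    · rw [show m * p⁻¹ * (m⁻¹ * p) = m * (m * p)⁻¹ * p by group, hc.eq]
      simp
  · rw [← hp, ← hm, ← Units.val_mul]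
    simp

end Density

/-! ### Isometries and self-adjoint extensions on finite dimensional subspaces -/

section Operators

variable {H : Type*} [NormedAddCommGroup H] [InnerProductSpace ℂ H] [CompleteSpace H]

/-- A symmetric operator defined on a finite dimensional subspace extends to a bounded self-adjoint
operator. -/
theorem exists_isSelfAdjoint_extension (D : Submodule ℂ H) [FiniteDimensional ℂ D] (T : D →ₗ[ℂ] H)
    (hT : ∀ x y : D, inner ℂ (T x) (y : H) = inner ℂ (x : H) (T y)) :
    ∃ X : H →L[ℂ] H, IsSelfAdjoint X ∧ ∀ x : D, X x = T x := by
  let P : H →L[ℂ] H := D.starProjection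
  let R : H →L[ℂ] H := LinearMap.toContinuousLinearMap T ∘L D.orthogonalProjectionOnto
  have hR : ∀ x, R x = T (D.orthogonalProjectionOnto x) := fun x => rfl
  have hPs : ∀ x y, inner ℂ (P x) y = inner ℂ x (P y) := D.inner_starProjection_left_eq_right
  have hRP : ∀ x y, inner ℂ (R x) (P y) = inner ℂ (P x) (R y) := fun x y => hT _ _
  have hadj : ∀ x, (ContinuousLinearMap.adjoint R) (P x) = P (R x) := fun x => by
    refine ext_inner_left ℂ fun v => ?_
    rw [ContinuousLinearMap.adjoint_inner_right, hRP, hPs]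
  -- With respect to `D ⊕ Dᗮ` this is the self-adjoint block operator with first column `T` and zero
  -- in the `Dᗮ` corner. The diagonal block `P R` occurs in both `R` and its adjoint, hence is
  -- subtracted once.
  refine ⟨R + ContinuousLinearMap.adjoint R - P ∘L R, ?_, fun x => ?_⟩
  · rw [ContinuousLinearMap.isSelfAdjoint_iff_isSymmetric]
    intro x y
    simp only [ContinuousLinearMap.coe_coe, _root_.add_apply,
      _root_.sub_apply, ContinuousLinearMap.comp_apply, inner_add_left,
      inner_add_right, inner_sub_left, inner_sub_right, ContinuousLinearMap.adjoint_inner_left,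
      ContinuousLinearMap.adjoint_inner_right, hPs, hRP]
    ring
  · have hx : P x = x := D.starProjection_mem_subspace_eq_self x
    have h2 := hadj x
    rw [hx] at h2
    have h3 : R x = T x := by rw [hR, D.orthogonalProjectionOnto_mem_subspace_eq_self]
    simp [h2, h3]

-- An infinite dimensional `F` has a subspace of the dimension of `K`; matching orthonormal bases
-- gives the isometry. `F` need not be closed.
omit [CompleteSpace H] in
theorem exists_linearIsometry_of_infinite (K F : Submodule ℂ H) [FiniteDimensional ℂ K]
    (hF : ¬ FiniteDimensional ℂ F) :
    ∃ J : K →ₗᵢ[ℂ] H, ∀ x, J x ∈ F := by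
  have hr : (Module.finrank ℂ K : Cardinal) ≤ Module.rank ℂ F := by
    refine (Cardinal.natCast_lt_aleph0.le).trans ?_
    by_contra h
    exact hF (Module.rank_lt_aleph0_iff.1 (not_le.1 h))
  obtain ⟨v, hv⟩ := Module.le_rank_iff.1 hr
  let W : Submodule ℂ F := Submodule.span ℂ (Set.range v)
  have hW : Module.finrank ℂ W = Module.finrank ℂ K := by
    rw [finrank_span_eq_card hv, Fintype.card_fin]
  have : FiniteDimensional ℂ W := FiniteDimensional.span_of_finite ℂ (Set.finite_range v)
  let e : K ≃ₗᵢ[ℂ] W := (stdOrthonormalBasis ℂ K).equiv (stdOrthonormalBasis ℂ W)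
    (finCongr hW.symm)
  exact ⟨F.subtypeₗᵢ.comp (W.subtypeₗᵢ.comp e.toLinearIsometry), fun x => (e x : F).2⟩

/-- Every finite dimensional subspace `K` is mapped isometrically into the range of an infinite
dimensional projection `E`, by an isometry `U` with `⟨x, U x⟩ = ⟨x, E x⟩`, which fixes the vectors
of `K` in the range of `E`. -/
theorem exists_linearIsometry_into_range (K : Submodule ℂ H) [FiniteDimensional ℂ K]
    {E : H →L[ℂ] H} (hE : IsStarProjection E)
    (hEinf : ¬ FiniteDimensional ℂ (LinearMap.range (E : H →ₗ[ℂ] H))) :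
    ∃ U : K →ₗᵢ[ℂ] H, (∀ x, E (U x) = U x) ∧
      (∀ x : K, inner ℂ (x : H) (U x) = inner ℂ (x : H) (E x)) ∧
      ∀ x : K, E x = x → U x = x := by
  have hsymm : ∀ x y, inner ℂ (E x) y = inner ℂ x (E y) := fun x y => by
    conv_lhs => rw [← hE.isSelfAdjoint.star_eq]
    rw [ContinuousLinearMap.star_eq_adjoint, ContinuousLinearMap.adjoint_inner_left]
  have hidem : ∀ x, E (E x) = E x := fun x => DFunLike.congr_fun hE.isIdempotentElem.eq x
  let L : Submodule ℂ H := K.map (E : H →ₗ[ℂ] H)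
  let R : Submodule ℂ H := LinearMap.range (E : H →ₗ[ℂ] H)
  have hLR : L ≤ R := by
    rintro _ ⟨x, -, rfl⟩
    exact ⟨x, rfl⟩
  -- `R` is the sum of the finite dimensional `L` and `Lᗮ ⊓ R`, so the latter carries the infinite
  -- dimension.
  have hF : ¬ FiniteDimensional ℂ (Lᗮ ⊓ R : Submodule ℂ H) := fun h => hEinf <| by
    change FiniteDimensional ℂ R
    rw [← Submodule.sup_orthogonal_inf_of_hasOrthogonalProjection hLR]
    infer_instance
  let C : K →ₗ[ℂ] H := ((1 - E : H →L[ℂ] H) : H →ₗ[ℂ] H) ∘ₗ K.subtype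
  have hC : ∀ x : K, C x = x - E x := fun x => rfl
  obtain ⟨J, hJ⟩ := exists_linearIsometry_of_infinite (LinearMap.range C) (Lᗮ ⊓ R) hF
  have hJE : ∀ y, E (J y) = J y := fun y => by
    obtain ⟨z, hz⟩ := (hJ y).2
    rw [← hz]
    exact hidem z
  have hJL : ∀ (x : K) y, inner ℂ (E x) (J y) = 0 := fun x y =>
    (Submodule.mem_orthogonal _ _).1 (hJ y).1 _ ⟨x, x.2, rfl⟩
  -- `E x` is kept and `(1 - E) x` is moved by `J` into the range of `E`, orthogonally to `E K`.
  -- Pythagoras then gives isometry, and the moved part does not contribute to `⟨x, U x⟩`.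
  let U₀ : K →ₗ[ℂ] H := (E : H →ₗ[ℂ] H) ∘ₗ K.subtype + J.toLinearMap ∘ₗ C.rangeRestrict
  have hU₀ : ∀ x : K, U₀ x = E x + J (C.rangeRestrict x) := fun x => rfl
  have hnorm : ∀ x : K, ‖U₀ x‖ = ‖x‖ := by
    intro x
    have h1 : ‖U₀ x‖ * ‖U₀ x‖ = ‖E x‖ * ‖E x‖ + ‖(x : H) - E x‖ * ‖(x : H) - E x‖ := by
      rw [hU₀, norm_add_sq_eq_norm_sq_add_norm_sq_of_inner_eq_zero _ _ (hJL x _), J.norm_map]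
      rfl
    have h2 : ‖(x : H)‖ * ‖(x : H)‖ =
        ‖E x‖ * ‖E x‖ + ‖(x : H) - E x‖ * ‖(x : H) - E x‖ := by
      rw [← norm_add_sq_eq_norm_sq_add_norm_sq_of_inner_eq_zero (𝕜 := ℂ), add_sub_cancel]
      rw [hsymm, map_sub, hidem, sub_self, inner_zero_right]
    exact (mul_self_inj (norm_nonneg _) (norm_nonneg _)).1 (h1.trans h2.symm)
  refine ⟨⟨U₀, hnorm⟩, fun x => ?_, fun x => ?_, fun x hx => ?_⟩
  · change E (U₀ x) = U₀ x
    rw [hU₀, map_add, hidem, hJE]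
  · change inner ℂ (x : H) (U₀ x) = _
    -- Writing `J y` as `E (J y)` moves `E` onto `x`, where orthogonality to `E K` applies.
    rw [hU₀, inner_add_right, ← hJE, ← hsymm x (J _), hJL, add_zero]
  · change U₀ x = x
    have h0 : C.rangeRestrict x = 0 := Subtype.ext (by simp [hC, hx])
    rw [hU₀, h0, map_zero, add_zero, hx]

/-- An isometry on a finite dimensional subspace without nonzero fixed vectors is the Cayley
transform of a bounded self-adjoint operator. -/
theorem exists_isSelfAdjoint_cayley (K : Submodule ℂ H) [FiniteDimensional ℂ K] (W : K →ₗᵢ[ℂ] H)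
    (hW : ∀ x : K, W x = x → x = 0) :
    ∃ X : H →L[ℂ] H, IsSelfAdjoint X ∧ ∀ x : K, X (x - W x) = Complex.I • (x + W x) := by
  let B : K →ₗ[ℂ] H := K.subtype - W.toLinearMap
  have hB : ∀ x : K, B x = x - W x := fun x => rfl
  have hinj : Function.Injective B := by
    refine (injective_iff_map_eq_zero B).2 fun x hx => hW x ?_
    rw [hB, sub_eq_zero] at hx
    exact hx.symm
  let e : K ≃ₗ[ℂ] LinearMap.range B := LinearEquiv.ofInjective B hinj
  have he : ∀ x, (e x : H) = x - W x := fun x => rfl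
  let T₀ : K →ₗ[ℂ] H := Complex.I • (K.subtype + W.toLinearMap)
  have hT₀ : ∀ x : K, T₀ x = Complex.I • (x + W x) := fun x => rfl
  obtain ⟨X, hX, hXT⟩ := exists_isSelfAdjoint_extension (LinearMap.range B)
    -- The operator `i(1 + W)(1 - W)⁻¹`. In its symmetry relation the terms `⟨x, y⟩` and `⟨W x, W
    -- y⟩` cancel because `W` is isometric, and the cross terms agree.
    (T₀ ∘ₗ (e.symm : LinearMap.range B →ₗ[ℂ] K)) (fun x y => by
      obtain ⟨x, rfl⟩ := e.surjective x
      obtain ⟨y, rfl⟩ := e.surjective y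
      have := W.inner_map_map x y
      simp only [LinearMap.comp_apply, LinearEquiv.coe_coe, LinearEquiv.symm_apply_apply, he, hT₀,
        inner_smul_left, inner_smul_right, inner_add_left, inner_add_right, inner_sub_left,
        inner_sub_right, this, Complex.conj_I, Submodule.coe_inner]
      ring)
  refine ⟨X, hX, fun x => ?_⟩
  rw [← he, hXT]
  simp [hT₀]

end Operators

/-! ### Approximating isometries by unitaries of the algebra -/

section Transitivity

variable {A : Type*} [CStarAlgebra A] {H : Type*} [NormedAddCommGroup H] [InnerProductSpace ℂ H]
  [CompleteSpace H]

/-- In an irreducible representation, an isometry on a finite dimensional subspace without nonzero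
fixed vectors is approximated by unitaries of the algebra. -/
theorem exists_unitary_approx {π : A →⋆ₐ[ℂ] (H →L[ℂ] H)} (hπ : IsIrreducibleRep π)
    (K : Submodule ℂ H) [FiniteDimensional ℂ K] (W : K →ₗᵢ[ℂ] H)
    (hW : ∀ x : K, W x = x → x = 0) {δ : ℝ} (hδ : 0 < δ) :
    ∃ S ∈ unitary A, ∀ x : K, ‖π S x - W x‖ ≤ δ * ‖x‖ := by
  obtain ⟨X, hX, hXW⟩ := exists_isSelfAdjoint_cayley K W hW
  let e := stdOrthonormalBasis ℂ K
  let ζ : K →ₗ[ℂ] H := K.subtype - W.toLinearMap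
  have hζ : ∀ x : K, ζ x = x - W x := fun x => rfl
  let n : ℕ := Module.finrank ℂ K
  -- The tolerance is divided over the `n` basis vectors; `n + 1` keeps it meaningful for `n = 0`.
  obtain ⟨_, ⟨a, rfl⟩, ha⟩ := Metric.mem_closure_iff.1
    (mem_closure_range_selfAdjoint hπ hX fun i => ζ (e i)) (δ / (n + 1)) (by positivity)
  rw [dist_pi_lt_iff (by positivity)] at ha
  have hbound : ∀ x : K, ‖(X - π a) (ζ x)‖ ≤ δ * ‖x‖ := by
    intro x
    have hx : (X - π a) (ζ x) = ∑ i, e.repr x i • (X - π a) (ζ (e i)) := by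
      conv_lhs => rw [← e.sum_repr x]
      simp only [map_sum, map_smul]
    calc ‖(X - π a) (ζ x)‖ ≤ ∑ i, ‖e.repr x i • (X - π a) (ζ (e i))‖ := hx ▸ norm_sum_le _ _
      _ ≤ ∑ _i : Fin (Module.finrank ℂ K), ‖x‖ * (δ / (n + 1)) := by
        refine Finset.sum_le_sum fun i _ => ?_
        rw [norm_smul]
        refine mul_le_mul ?_ ?_ (norm_nonneg _) (norm_nonneg _)
        · rw [← e.repr.norm_map x]
          exact PiLp.norm_apply_le _ i
        · simpa [dist_eq_norm] using (ha i).le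
      _ = ‖x‖ * δ * (n / (n + 1)) := by simp [n]; ring
      _ ≤ ‖x‖ * δ * 1 := by
        refine mul_le_mul_of_nonneg_left ?_ (by positivity)
        rw [div_le_one (by positivity)]
        linarith
      _ = δ * ‖x‖ := by ring
  obtain ⟨u, hu, huI⟩ := exists_unitary_mul_add_I a.2
  refine ⟨u, hu, fun x => ?_⟩
  have hπI : π (algebraMap ℂ A Complex.I) = algebraMap ℂ (H →L[ℂ] H) Complex.I :=
    AlgHomClass.commutes π _
  have h1 : π u (π a (ζ x) + Complex.I • ζ x) = π a (ζ x) - Complex.I • ζ x := by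
    have := congrArg (fun b => π b (ζ x)) huI
    simpa [hπI, Algebra.algebraMap_eq_smul_one] using this
  have h2 : (X - π a) (ζ x) = Complex.I • (x + W x) - π a (ζ x) := by
    rw [_root_.sub_apply, hζ, hXW]
  have hu1 : ∀ y, ‖π u y‖ = ‖y‖ := fun y =>
    ContinuousLinearMap.norm_map_of_mem_unitary (Unitary.map_mem π hu) y
  -- With `z = x - W x` one has `(X + i) z = 2i x` and `(X - i) z = 2i W x`. Comparing with `u (a +
  -- i) = a - i` leaves `(π u - 1)(X - π a) z`, a bound free of `‖a‖`.
  have h3 : (2 * Complex.I) • (π u x - W x) = π u ((X - π a) (ζ x)) - (X - π a) (ζ x) := by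
    have h5 : (2 * Complex.I) • (x : H) =
        (Complex.I • (x + W x) - π a (ζ x)) + (π a (ζ x) + Complex.I • ζ x) := by
      rw [hζ]
      module
    rw [h2, smul_sub, ← map_smul, h5, map_add, h1, hζ]
    module
  have h4 : 2 * ‖π u x - W x‖ ≤ 2 * (δ * ‖x‖) := by
    calc 2 * ‖π u x - W x‖ = ‖(2 * Complex.I) • (π u x - W x)‖ := by simp [norm_smul]
      _ ≤ ‖π u ((X - π a) (ζ x))‖ + ‖(X - π a) (ζ x)‖ := by rw [h3]; exact norm_sub_le _ _
      _ ≤ 2 * (δ * ‖x‖) := by rw [hu1]; linarith [hbound x]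
  linarith

end Transitivity

end DynAlg

end

/-! ### The unitary for the given projection, and the estimates -/

theorem mainTheorem4 {N s : ℕ} (V : DynAlg.Config N s →ᵇ ℝ)
    {H : Type*} [NormedAddCommGroup H] [InnerProductSpace ℂ H] [CompleteSpace H]
    (π : DynAlg.DynamicalAlgebra V →⋆ₐ[ℂ] (H →L[ℂ] H)) (hπ : DynAlg.IsIrreducibleRep π)
    (HN : Submodule ℂ H) (hHN : FiniteDimensional ℂ HN)
    (E : H →L[ℂ] H) (hEmem : E ∈ DynAlg.weakClosure π) (hE : IsStarProjection E)
    (hEinf : ¬ FiniteDimensional ℂ (LinearMap.range (E : H →ₗ[ℂ] H)))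
    (ε : ℝ) (hε : 0 < ε) :
    ∃ S ∈ unitary (DynAlg.DynamicalAlgebra V), ∀ Ω ∈ HN, ‖Ω‖ = 1 →
      DynAlg.transformedState π Ω S (1 - E) < (ε : ℂ) ∧
      ‖(DynAlg.transitionProbability π Ω S : ℂ) - DynAlg.vectorState Ω E ^ 2‖ < ε := by
  obtain ⟨U, hEU, hinner, hfix⟩ := DynAlg.exists_linearIsometry_into_range HN hE hEinf
  let W : HN →ₗᵢ[ℂ] H := (LinearIsometryEquiv.neg ℂ).toLinearIsometry.comp U
  have hW : ∀ x, W x = -U x := fun x => rfl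
  have hW0 : ∀ x : HN, W x = x → x = 0 := by
    intro x hx
    rw [hW] at hx
    -- A fixed vector `x = -U x` lies in the range of `E`, where `U` acts trivially; hence `x = -x`.
    have hUx : U x = x := hfix x (by rw [← hx, map_neg, hEU])
    rw [hUx, neg_eq_iff_add_eq_zero, ← two_smul ℂ, smul_eq_zero] at hx
    exact Subtype.ext (hx.resolve_left two_ne_zero)
  obtain ⟨S, hS, hSW⟩ := DynAlg.exists_unitary_approx hπ HN W hW0
    -- The bound `1` gives `‖η‖² ≤ ‖η‖` for the first estimate; `ε / 3` leaves room for the factor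
    -- `2` in the second.
    (δ := min 1 (ε / 3)) (by positivity)
  refine ⟨S, hS, fun Ω hΩ hΩ1 => ?_⟩
  have hδ := hSW ⟨Ω, hΩ⟩
  set η : H := π S Ω - W ⟨Ω, hΩ⟩ with hη
  rw [Submodule.coe_norm, hΩ1, mul_one] at hδ
  have hη1 : ‖η‖ ≤ 1 := hδ.trans (min_le_left _ _)
  have hηε : ‖η‖ ≤ ε / 3 := hδ.trans (min_le_right _ _)
  have hπS : π S Ω = W ⟨Ω, hΩ⟩ + η := by rw [hη]; abel
  constructor
  · have h1E : IsStarProjection (1 - E) := hE.one_sub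
    -- `W Ω` lies in the range of `E`, so only the error `η` is seen by `1 - E`.
    have h0 : (1 - E) (π S Ω) = (1 - E) η := by
      rw [hπS, map_add]
      simp [hW, hEU]
    have h1 : DynAlg.transformedState π Ω S (1 - E) = ((‖(1 - E) η‖ ^ 2 : ℝ) : ℂ) := by
      rw [DynAlg.transformedState_apply, ← h0]
      change inner ℂ (π S Ω) ((1 - E) (π S Ω)) = _
      conv_lhs => rw [← h1E.isIdempotentElem.eq]
      rw [mul_apply_eq_comp, ← ContinuousLinearMap.adjoint_inner_left,
        ← ContinuousLinearMap.star_eq_adjoint, h1E.isSelfAdjoint.star_eq,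
        inner_self_eq_norm_sq_to_K]
      push_cast
      rfl
    rw [h1, Complex.real_lt_real]
    have h2 : ‖(1 - E) η‖ ≤ ‖η‖ :=
      ((1 - E).le_opNorm η).trans (mul_le_of_le_one_left (norm_nonneg _) h1E.norm_le)
    nlinarith [norm_nonneg ((1 - E) η), norm_nonneg η]
  · have hsymm : inner ℂ Ω (E Ω) = ((‖E Ω‖ ^ 2 : ℝ) : ℂ) := by
      conv_lhs => rw [← hE.isIdempotentElem.eq]
      rw [mul_apply_eq_comp, ← ContinuousLinearMap.adjoint_inner_left,
        ← ContinuousLinearMap.star_eq_adjoint, hE.isSelfAdjoint.star_eq,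
        inner_self_eq_norm_sq_to_K]
      push_cast
      rfl
    have hz : DynAlg.vectorState Ω (π S) = -((‖E Ω‖ ^ 2 : ℝ) : ℂ) + inner ℂ Ω η := by
      change inner ℂ Ω (π S Ω) = _
      rw [hπS, inner_add_right, hW, inner_neg_right, hinner ⟨Ω, hΩ⟩, hsymm]
    have hw : DynAlg.vectorState Ω E = ((‖E Ω‖ ^ 2 : ℝ) : ℂ) := hsymm
    have hEΩ : ‖E Ω‖ ≤ 1 := by
      simpa [hΩ1] using (E.le_opNorm Ω).trans
        (mul_le_of_le_one_left (norm_nonneg _) hE.norm_le)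
    have hp : ‖E Ω‖ ^ 2 ≤ 1 := pow_le_one₀ (norm_nonneg _) hEΩ
    have hc : ‖DynAlg.vectorState Ω (π S)‖ ≤ 1 := by
      have h1 : ‖π S Ω‖ = 1 :=
        (ContinuousLinearMap.norm_map_of_mem_unitary (Unitary.map_mem π hS) Ω).trans hΩ1
      exact (norm_inner_le_norm (𝕜 := ℂ) Ω (π S Ω)).trans (by rw [hΩ1, h1, one_mul])
    have hd : |‖DynAlg.vectorState Ω (π S)‖ - ‖E Ω‖ ^ 2| ≤ ‖η‖ := by
      have h1 := abs_norm_sub_norm_le (DynAlg.vectorState Ω (π S)) (-((‖E Ω‖ ^ 2 : ℝ) : ℂ))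
      rw [norm_neg, Complex.norm_real, Real.norm_of_nonneg (by positivity)] at h1
      refine h1.trans ?_
      rw [hz, add_sub_cancel_left]
      simpa [hΩ1] using norm_inner_le_norm (𝕜 := ℂ) Ω η
    -- Both `|ω(S)|` and `ω(E) = ‖E Ω‖²` are at most `1`, so their squares differ by at most `2
    -- ‖η‖`.
    rw [DynAlg.transitionProbability, hw, ← Complex.ofReal_pow, ← Complex.ofReal_sub,
      Complex.norm_real, Real.norm_eq_abs, sq_sub_sq, abs_mul]
    have hs : |‖DynAlg.vectorState Ω (π S)‖ + ‖E Ω‖ ^ 2| ≤ 2 := by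
      rw [abs_of_nonneg (by positivity)]
      linarith
    have := mul_le_mul hs hd (abs_nonneg _) zero_le_two
    linarith
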